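/- For every real number $\varepsilon>0$ there is a positive integer $n$, depending only on $\varepsilon$, with the following property. Let $G$ be a finite group, and let $F^*(G)$ be its generalized Fitting subgroup, that is, the product of the Fitting subgroup $F(G)$ (the largest nilpotent normal subgroup) and all subnormal quasisimple subgroups of $G$, where a group is quasisimple if it is perfect and its quotient by the centre is a non-abelian simple group. For a subgroup $K\le G$ put $$Pr(K,G)=\frac{|\{(x,y)\in K\times G : xy=yx\}|}{|K||G|}.$$ If $Pr(F^*(G),G)\ge\varepsilon$, then $G$ has a normal subgroup $R$, nilpotent of class at most $2$, such that $[G:R]\le n$ and $|[R,R]|\le n$, where $[R,R]$ is the commutator subgroup of $R$. -/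

import Mathlib

/-- The probability that a random element of the subgroup `K` commutes with a random element
of `G` (the relative commutativity degree of `K` in `G`). -/
noncomputable def relCommProb {G : Type*} [Group G] (K : Subgroup G) : ℝ :=
  (Nat.card {p : K × G // (p.1 : G) * p.2 = p.2 * (p.1 : G)} : ℝ) /
    ((Nat.card K : ℝ) * (Nat.card G : ℝ))

/-- A group is quasisimple if it is perfect and its quotient by the centre is a non-abelian
simple group. -/
structure IsQuasisimpleGroup (H : Type*) [Group H] : Prop where
  perfect : Group.IsPerfect H
  simple : IsSimpleGroup (H ⧸ Subgroup.center H)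
  nonabelian : ∃ a b : H ⧸ Subgroup.center H, a * b ≠ b * a

/-- The Fitting subgroup: the subgroup generated by all nilpotent normal subgroups (for finite
groups, the largest nilpotent normal subgroup). -/
def fittingSubgroup (G : Type*) [Group G] : Subgroup G :=
  sSup {N : Subgroup G | N.Normal ∧ Group.IsNilpotent N}

/-- The subgroup generated by all subnormal quasisimple subgroups. -/
def layerSubgroup (G : Type*) [Group G] : Subgroup G :=
  sSup {H : Subgroup G | H.IsSubnormal ∧ IsQuasisimpleGroup H}

/-- The generalized Fitting subgroup `F*(G)`: the product of the Fitting subgroup and all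
subnormal quasisimple subgroups. The join is this product, because `fittingSubgroup G` is normal
and, for finite `G`, distinct subnormal quasisimple subgroups commute elementwise. -/
def generalizedFittingSubgroup (G : Type*) [Group G] : Subgroup G :=
  fittingSubgroup G ⊔ layerSubgroup G

open scoped Pointwise commutatorElement

/-! ### Bounded generation by large symmetric subsets -/

section Growth

variable {G : Type*} [Group G] [DecidableEq G]

/-! Write `K` for $F^*(G)$. Only two facts about it are used: $C_G(K)\le K$, and `K` contains every
nilpotent normal subgroup. By averaging, many elements of `K` have few conjugates. They generate a
normal `B` of bounded index in `K`; its elements are bounded products of generators, so their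
classes are bounded too (`exists_normal_classSize_le`). The same argument with the roles exchanged
gives a normal `E` of bounded index in `G` with bounded `B`-classes. A Neumann-type count bounds the
commutators $[b,e]$, and their centralizer `C` has bounded index, with $[B\cap C,E\cap C]$ small and
centralized by `C`. A normal `T` of bounded index then stabilizes $K\ge B\cap C\ge[B\cap C,E\cap
C]\ge1$. Since $C_G(K)\le K$, `T` is nilpotent (`isNilpotent_of_stabilizes`), so $T\le K$. Thus `K`
has bounded index in `G`, and $R=B\cap C\cap T$ works. -/

theorem Finset.card_add_card_pow_le {X : Finset G} (h1 : 1 ∈ X) (hinv : X⁻¹ = X) {i : ℕ}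
    (h : X ^ (i + 2) ≠ X ^ (i + 1)) :
    (X ^ i).card + X.card ≤ (X ^ (i + 3)).card := by
  have hsub : X ^ (i + 1) ⊆ X ^ (i + 2) := Finset.pow_subset_pow_right h1 (by omega)
  obtain ⟨g, hg, hg'⟩ : ∃ g ∈ X ^ (i + 2), g ∉ X ^ (i + 1) := by
    by_contra! hc
    exact h (Finset.Subset.antisymm hc hsub)
  -- If $gx\in X^i$, then $g\in X^iX^{-1}=X^{i+1}$, contrary to the choice of `g`.
  have hdisj : Disjoint (X ^ i) (g • X) := by
    rw [Finset.disjoint_left]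
    rintro y hy hy'
    obtain ⟨x, hx, rfl⟩ := Finset.mem_smul_finset.1 hy'
    apply hg'
    have hx' : x⁻¹ ∈ X := by rw [← hinv]; exact Finset.inv_mem_inv hx
    have := Finset.mul_mem_mul hy hx'
    rw [← pow_succ] at this
    simpa using this
  rw [← Finset.card_smul_finset g X, ← Finset.card_union_of_disjoint hdisj]
  apply Finset.card_le_card
  apply Finset.union_subset (Finset.pow_subset_pow_right h1 (by omega))
  intro y hy
  obtain ⟨x, hx, rfl⟩ := Finset.mem_smul_finset.1 hy
  rw [pow_succ]
  exact Finset.mul_mem_mul hg hx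

theorem Finset.mul_card_le_card_pow {X : Finset G} (h1 : 1 ∈ X) (hinv : X⁻¹ = X) (k : ℕ)
    (h : ∀ i < k, X ^ (3 * i + 3) ≠ X ^ (3 * i + 2)) :
    (k + 1) * X.card ≤ (X ^ (3 * k + 1)).card := by
  induction k with
  | zero => simp
  | succ k ih =>
    have h₁ := ih fun i hi => h i (by omega)
    have h₂ := Finset.card_add_card_pow_le h1 hinv (h k (by omega))
    calc (k + 1 + 1) * X.card = (k + 1) * X.card + X.card := by ring
      _ ≤ _ := by
        refine (Nat.add_le_add_right h₁ _).trans h₂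

/-- A symmetric subset containing at least a proportion `1 / m` of a finite subgroup `H` generates
a subgroup all of whose elements are products of fewer than `3 * m` generators. -/
theorem Subgroup.closure_subset_pow_of_card_le {H : Subgroup G} [Finite H] {X : Finset G} {m : ℕ}
    (h1 : 1 ∈ X) (hinv : X⁻¹ = X) (hX : (X : Set G) ⊆ H) (hcard : Nat.card H ≤ m * X.card) :
    (Subgroup.closure (X : Set G) : Set G) ⊆ ((X ^ (3 * m) : Finset G) : Set G) := by
  have hpow : ∀ j, ((X ^ j : Finset G) : Set G) ⊆ H := by
    intro j
    induction j with
    | zero => simp [H.one_mem]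
    | succ j ih =>
      rw [pow_succ, Finset.coe_mul]
      rintro _ ⟨a, ha, b, hb, rfl⟩
      exact H.mul_mem (ih ha) (hX hb)
  -- Otherwise the powers gain $|X|$ elements every three steps, and $X^{3m+1}$ outgrows `H`.
  obtain ⟨i, hi, hi'⟩ : ∃ i < m, X ^ (3 * i + 3) = X ^ (3 * i + 2) := by
    by_contra! hc
    have h₁ := Finset.mul_card_le_card_pow h1 hinv m hc
    have h₂ : (X ^ (3 * m + 1)).card ≤ Nat.card H := by
      rw [← Set.ncard_coe_finset]
      exact Set.ncard_le_ncard (hpow _) (Set.toFinite (H : Set G))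
    have h₃ : 0 < X.card := Finset.card_pos.2 ⟨1, h1⟩
    nlinarith
  have hmul : ∀ x ∈ X ^ (3 * i + 2), ∀ y ∈ X, x * y ∈ X ^ (3 * i + 2) := by
    intro x hx y hy
    rw [← hi', pow_succ]
    exact Finset.mul_mem_mul hx hy
  have hsub : X ^ (3 * i + 2) ⊆ X ^ (3 * m) := Finset.pow_subset_pow_right h1 (by omega)
  intro x hx
  apply hsub
  induction hx using Subgroup.closure_induction_right with
  | one => exact Finset.one_mem_pow h1
  | mul_right x hx y hy ih => exact hmul x ih y hy
  | mul_inv_cancel x hx y hy ih =>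
    refine hmul x ih _ ?_
    rw [← hinv]
    exact Finset.inv_mem_inv hy

end Growth

/-! ### Conjugacy class sizes relative to a subgroup -/

section ClassSize

variable {G : Type*} [Group G]

namespace Subgroup

/-- The number of conjugates of `x` under elements of `L`. -/
noncomputable def classSize (L : Subgroup G) (x : G) : ℕ :=
  (centralizer {x}).relIndex L

variable (L : Subgroup G)

theorem ncard_conj_image (x : G) :
    ((fun e => e * x * e⁻¹) '' (L : Set G)).ncard = L.classSize x := by
  let _ : MulAction L G := MulAction.compHom G ((MulAut.conj : G →* MulAut G).comp L.subtype)
  have hs : MulAction.stabilizer L x = (centralizer {x}).subgroupOf L := by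
    ext ⟨g, hg⟩
    rw [MulAction.mem_stabilizer_iff, mem_subgroupOf, mem_centralizer_singleton_iff]
    change g * x * g⁻¹ = x ↔ _
    rw [mul_inv_eq_iff_eq_mul]
  have ho : MulAction.orbit L x = (fun e => e * x * e⁻¹) '' (L : Set G) := by
    ext y
    constructor
    · rintro ⟨⟨g, hg⟩, rfl⟩
      exact ⟨g, hg, rfl⟩
    · rintro ⟨g, hg, rfl⟩
      exact ⟨⟨g, hg⟩, rfl⟩
  rw [← ho, ← MulAction.index_stabilizer, hs]
  rfl

theorem classSize_one : L.classSize 1 = 1 := by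
  rw [classSize, relIndex_eq_one]
  intro x _
  simp [mem_centralizer_singleton_iff]

theorem classSize_inv (x : G) : L.classSize x⁻¹ = L.classSize x := by
  have : centralizer {x⁻¹} = centralizer {x} := by
    ext g
    simp only [mem_centralizer_singleton_iff]
    exact Commute.inv_right_iff
  rw [classSize, this, classSize]

theorem classSize_mul_le [Finite G] (x y : G) : L.classSize (x * y) ≤ L.classSize x * L.classSize y := by
  refine le_trans (relIndex_le_of_le_left ?_ index_ne_zero_of_finite) relIndex_inf_le
  intro g hg
  simp only [mem_inf, mem_centralizer_singleton_iff] at hg ⊢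
  exact Commute.mul_right hg.1 hg.2

theorem classSize_conj [hL : L.Normal] (g x : G) : L.classSize (g * x * g⁻¹) = L.classSize x := by
  rw [← ncard_conj_image, ← ncard_conj_image,
    ← Set.ncard_image_of_injective ((fun e => e * x * e⁻¹) '' (L : Set G))
      (MulAut.conj g).injective]
  congr 1
  ext y
  simp only [Set.mem_image, SetLike.mem_coe, MulAut.conj_apply, exists_exists_and_eq_and]
  constructor
  · rintro ⟨e, he, rfl⟩
    exact ⟨g⁻¹ * e * g, by simpa using hL.conj_mem e he g⁻¹, by group⟩
  · rintro ⟨e, he, rfl⟩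
    exact ⟨g * e * g⁻¹, hL.conj_mem e he g, by group⟩

theorem classSize_pow_le [Finite G] [DecidableEq G] {X : Finset G} {M : ℕ} (hX : ∀ x ∈ X, L.classSize x ≤ M)
    (j : ℕ) : ∀ x ∈ X ^ j, L.classSize x ≤ M ^ j := by
  induction j with
  | zero => simp [classSize_one]
  | succ j ih =>
    intro x hx
    rw [pow_succ] at hx
    obtain ⟨a, ha, b, hb, rfl⟩ := Finset.mem_mul.1 hx
    rw [pow_succ]
    exact (L.classSize_mul_le a b).trans (Nat.mul_le_mul (ih a ha) (hX b hb))

theorem card_inf_mul_classSize (x : G) :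
    Nat.card (centralizer {x} ⊓ L : Subgroup G) * L.classSize x = Nat.card L := by
  rw [classSize, ← inf_relIndex_right, ← relIndex_bot_left, ← relIndex_bot_left,
    relIndex_mul_relIndex _ _ _ bot_le inf_le_right]

/-- The number of commuting pairs in `H × L`. -/
noncomputable def commutingPairs (H L : Subgroup G) : ℕ :=
  Nat.card {p : H × L // (p.1 : G) * p.2 = p.2 * (p.1 : G)}

theorem commutingPairs_comm (H L : Subgroup G) : commutingPairs H L = commutingPairs L H :=
  Nat.card_congr
    { toFun := fun p => ⟨p.1.swap, p.2.symm⟩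
      invFun := fun p => ⟨p.1.swap, p.2.symm⟩
      left_inv := fun _ => rfl
      right_inv := fun _ => rfl }

theorem commutingPairs_eq_sum [Finite G] (H L : Subgroup G) [Fintype H] :
    commutingPairs H L = ∑ x : H, Nat.card (centralizer {(x : G)} ⊓ L : Subgroup G) := by
  rw [← Nat.card_sigma]
  exact Nat.card_congr
    { toFun := fun p => ⟨p.1.1, ⟨p.1.2, mem_inf.2
        ⟨mem_centralizer_singleton_iff.2 p.2.symm, p.1.2.2⟩⟩⟩
      invFun := fun q => ⟨⟨q.1, ⟨q.2.1, (mem_inf.1 q.2.2).2⟩⟩,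
        (mem_centralizer_singleton_iff.1 (mem_inf.1 q.2.2).1).symm⟩
      left_inv := fun _ => rfl
      right_inv := fun _ => rfl }

/-- If a positive proportion of the pairs in `H × L` commute, then many elements of `H` have
few `L`-conjugates. -/
theorem card_le_mul_card_filter_classSize [Finite G] (H L : Subgroup G) [Fintype H] {k : ℕ}
    (h : Nat.card H * Nat.card L ≤ k * commutingPairs H L) :
    Nat.card H ≤ 2 * k * (Finset.univ.filter fun x : H => L.classSize x ≤ 2 * k).card := by
  classical
  set X := Finset.univ.filter fun x : H => L.classSize x ≤ 2 * k with hXdef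
  have hL : 0 < Nat.card L := Nat.card_pos
  -- Markov's inequality: an element with more than `2 * k` conjugates contributes at most $|L|/2k$
  -- commuting pairs, so such elements account for at most half of the assumed count.
  have hbound : ∀ x : H, 2 * k * Nat.card (centralizer {(x : G)} ⊓ L : Subgroup G) ≤
      Nat.card L + (if x ∈ X then 2 * k * Nat.card L else 0) := by
    intro x
    split_ifs with hx
    · refine le_trans (Nat.mul_le_mul_left _ ?_) (Nat.le_add_left _ _)
      exact card_le_of_le inf_le_right
    · have hx' : 2 * k < L.classSize x := by simpa [hXdef] using hx
      rw [← L.card_inf_mul_classSize x]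
      nlinarith
  have hsum := Finset.sum_le_sum fun x (_ : x ∈ Finset.univ) => hbound x
  rw [← Finset.mul_sum, ← commutingPairs_eq_sum, Finset.sum_add_distrib, Finset.sum_const,
    Finset.card_univ, ← Finset.sum_filter, Finset.sum_const, ← Nat.card_eq_fintype_card] at hsum
  simp only [Finset.filter_mem_eq_inter, Finset.univ_inter, smul_eq_mul] at hsum
  have : Nat.card H * Nat.card L ≤ 2 * k * X.card * Nat.card L := by nlinarith
  exact Nat.le_of_mul_le_mul_right this hL

theorem normal_closure_of_conj_mem {S : Set G} (h : ∀ g, ∀ x ∈ S, g * x * g⁻¹ ∈ S) :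
    (closure S).Normal := by
  refine ⟨fun n hn g => ?_⟩
  have : MulAut.conj g n ∈ (closure S).map (MulAut.conj g).toMonoidHom := ⟨n, hn, rfl⟩
  rw [MonoidHom.map_closure] at this
  refine closure_mono ?_ this
  rintro _ ⟨x, hx, rfl⟩
  exact h g x hx

/-- The elements with at most `2 * k` conjugates form a symmetric, conjugation-invariant set of
proportion at least `1 / (2 * k)`. Products of `3 * (2 * k)` of them exhaust the subgroup they
generate, and class sizes are submultiplicative. -/
theorem exists_normal_classSize_le [Finite G] (H L : Subgroup G) [H.Normal] [L.Normal] {k : ℕ} (hk : 1 ≤ k)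
    (h : Nat.card H * Nat.card L ≤ k * commutingPairs H L) :
    ∃ B : Subgroup G, B ≤ H ∧ B.Normal ∧ B.relIndex H ≤ 2 * k ∧
      ∀ b ∈ B, L.classSize b ≤ (2 * k) ^ (3 * (2 * k)) := by
  classical
  have : Fintype H := Fintype.ofFinite H
  set Y := Finset.univ.filter fun x : H => L.classSize x ≤ 2 * k with hYdef
  set X : Finset G := Y.map (Function.Embedding.subtype _) with hXdef
  have hmem : ∀ x, x ∈ X ↔ x ∈ H ∧ L.classSize x ≤ 2 * k := by
    intro x
    simp [hXdef, hYdef, and_comm]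
  have hcard : Nat.card H ≤ 2 * k * X.card := by
    rw [hXdef, Finset.card_map]
    exact card_le_mul_card_filter_classSize H L h
  have hXH : (X : Set G) ⊆ H := fun x hx => ((hmem x).1 hx).1
  have h1 : 1 ∈ X := (hmem 1).2 ⟨H.one_mem, by rw [classSize_one]; omega⟩
  have hinv : X⁻¹ = X := by
    ext x
    rw [Finset.mem_inv', hmem, hmem, inv_mem_iff, classSize_inv]
  refine ⟨closure (X : Set G), (closure_le H).2 hXH, ?_, ?_, ?_⟩
  · refine normal_closure_of_conj_mem fun g x hx => ?_
    obtain ⟨h₁, h₂⟩ := (hmem x).1 hx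
    exact (hmem _).2 ⟨Normal.conj_mem inferInstance x h₁ g, by rwa [classSize_conj]⟩
  · have hpos : 0 < Nat.card (closure (X : Set G)) := Nat.card_pos
    have h₂ : X.card ≤ Nat.card (closure (X : Set G)) := by
      rw [← Set.ncard_coe_finset]
      exact Set.ncard_le_ncard subset_closure (Set.toFinite (closure (X : Set G) : Set G))
    have h₃ : Nat.card (closure (X : Set G)) * (closure (X : Set G)).relIndex H = Nat.card H := by
      rw [← relIndex_bot_left, ← relIndex_bot_left,
        relIndex_mul_relIndex _ _ _ bot_le ((closure_le H).2 hXH)]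
    have : Nat.card (closure (X : Set G)) * (closure (X : Set G)).relIndex H ≤
        Nat.card (closure (X : Set G)) * (2 * k) := by
      rw [h₃]; nlinarith
    exact Nat.le_of_mul_le_mul_left this hpos
  · intro b hb
    exact L.classSize_pow_le (fun x hx => ((hmem x).1 hx).2) _ b
      (closure_subset_pow_of_card_le h1 hinv hXH hcard hb)

end Subgroup

end ClassSize

namespace Subgroup

variable {G : Type*} [Group G]

/-! ### Commutators of subgroups with bounded relative class sizes -/

theorem exists_finset_leftTransversal [Finite G] (U B : Subgroup G) :
    ∃ S : Finset G, (S : Set G) ⊆ B ∧ S.card ≤ U.relIndex B ∧ ∀ x ∈ B, ∃ s ∈ S, s⁻¹ * x ∈ U := by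
  classical
  have : Fintype (B ⧸ U.subgroupOf B) := Fintype.ofFinite _
  refine ⟨Finset.univ.image fun q : B ⧸ U.subgroupOf B => (q.out : G), ?_, ?_, ?_⟩
  · intro x hx
    obtain ⟨q, -, rfl⟩ := Finset.mem_image.1 (Finset.mem_coe.1 hx)
    exact q.out.2
  · refine Finset.card_image_le.trans ?_
    rw [Finset.card_univ, ← Nat.card_eq_fintype_card]
    rfl
  · intro x hx
    refine ⟨_, Finset.mem_image_of_mem _ (Finset.mem_univ (QuotientGroup.mk ⟨x, hx⟩)), ?_⟩
    have := QuotientGroup.eq.1 (QuotientGroup.out_eq' (QuotientGroup.mk (s := U.subgroupOf B) ⟨x, hx⟩))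
    exact this

/-- A form of Neumann's theorem on groups with boundedly finite conjugacy classes. -/
theorem ncard_commutators_le [Finite G] (B E : Subgroup G) {n m : ℕ} (hm1 : 1 ≤ m)
    (hn : ∀ b ∈ B, E.classSize b ≤ n) (hm : ∀ e ∈ E, B.classSize e ≤ m) :
    {x | ∃ b ∈ B, ∃ e ∈ E, ⁅b, e⁆ = x}.ncard ≤ m ^ n * (n * n * n) := by
  classical
  obtain ⟨O, hO, hOcard⟩ : ∃ O : G → Finset G, (∀ b y, y ∈ O b ↔ ∃ e ∈ E, e * b * e⁻¹ = y) ∧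
      ∀ b, (O b).card = E.classSize b := by
    refine ⟨fun b => (Set.toFinite ((fun e => e * b * e⁻¹) '' (E : Set G))).toFinset, ?_, ?_⟩
    · intro b y
      simp
    · intro b
      rw [← ncard_conj_image, ← Set.ncard_eq_toFinset_card]
  -- Neumann's trick: take `b` with the largest `E`-class. If `u` commutes with the chosen
  -- conjugators of `b`, then $u^{-1}O(b)\subseteq O(u^{-1}b)$, and maximality forces equality.
  obtain ⟨b, hbB, hbmax⟩ : ∃ b ∈ B, ∀ b' ∈ B, (O b').card ≤ (O b).card :=
    Set.exists_max_image (B : Set G) (fun b => (O b).card) (Set.toFinite _) ⟨1, B.one_mem⟩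
  have hrep : ∀ y : O b, ∃ e ∈ E, e * b * e⁻¹ = (y : G) := fun y => (hO b y).1 y.2
  choose r hrE hr using hrep
  set U : Subgroup G := ⨅ y : O b, centralizer {r y} with hU
  have hUindex : U.relIndex B ≤ m ^ n := by
    refine (relIndex_iInf_le _).trans ?_
    refine (Finset.prod_le_pow_card _ _ m fun y _ => hm _ (hrE y)).trans ?_
    rw [Finset.card_univ, Fintype.card_coe]
    exact Nat.pow_le_pow_right hm1 ((hOcard b).trans_le (hn b hbB))
  have key : ∀ u ∈ U, u ∈ B → ∀ g ∈ E, ⁅u, g⁆ ∈ O b * (O b)⁻¹ := by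
    intro u huU huB g hg
    have hsub : (O b).image (fun y => u⁻¹ * y) ⊆ O (u⁻¹ * b) := by
      intro z hz
      obtain ⟨y, hy, rfl⟩ := Finset.mem_image.1 hz
      have hc : u * r ⟨y, hy⟩ = r ⟨y, hy⟩ * u := by
        have := (mem_iInf.1 huU) ⟨y, hy⟩
        exact (mem_centralizer_singleton_iff.1 this)
      have hc' : r ⟨y, hy⟩ * u⁻¹ = u⁻¹ * r ⟨y, hy⟩ := by
        rw [eq_inv_mul_iff_mul_eq, ← mul_assoc, hc, mul_inv_cancel_right]
      refine (hO _ _).2 ⟨r ⟨y, hy⟩, hrE _, ?_⟩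
      rw [← mul_assoc, hc', mul_assoc u⁻¹, mul_assoc u⁻¹, hr ⟨y, hy⟩]
    have heq := Finset.eq_of_subset_of_card_le hsub (by
      rw [Finset.card_image_of_injective _ (mul_right_injective u⁻¹)]
      exact hbmax _ (B.mul_mem (B.inv_mem huB) hbB))
    have hmem : g * (u⁻¹ * b) * g⁻¹ ∈ O (u⁻¹ * b) := (hO _ _).2 ⟨g, hg, rfl⟩
    rw [← heq] at hmem
    obtain ⟨y, hy, hy'⟩ := Finset.mem_image.1 hmem
    have : ⁅u, g⁆ = y * (g * b * g⁻¹)⁻¹ := by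
      rw [eq_mul_inv_iff_mul_eq, ← mul_right_inj u⁻¹, hy', commutatorElement_def]
      group
    rw [this]
    exact Finset.mul_mem_mul hy (Finset.inv_mem_inv ((hO _ _).2 ⟨g, hg, rfl⟩))
  obtain ⟨S, hSB, hScard, hS⟩ := exists_finset_leftTransversal U B
  let W : G → Finset G := fun s =>
    (O b * (O b)⁻¹).image (fun a => s * a * s⁻¹) * (O s⁻¹).image (fun a => s * a)
  have hW : {x | ∃ b ∈ B, ∃ e ∈ E, ⁅b, e⁆ = x} ⊆ (S.biUnion W : Finset G) := by
    rintro _ ⟨x, hx, g, hg, rfl⟩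
    obtain ⟨s, hs, hsx⟩ := hS x hx
    refine Finset.mem_coe.2 (Finset.mem_biUnion.2 ⟨s, hs, ?_⟩)
    have : ⁅x, g⁆ = (s * ⁅s⁻¹ * x, g⁆ * s⁻¹) * (s * (g * s⁻¹ * g⁻¹)) := by
      simp only [commutatorElement_def]; group
    rw [this]
    exact Finset.mul_mem_mul
      (Finset.mem_image_of_mem _ (key _ hsx (B.mul_mem (B.inv_mem (hSB hs)) hx) g hg))
      (Finset.mem_image_of_mem _ ((hO _ _).2 ⟨g, hg, rfl⟩))
  refine (Set.ncard_le_ncard hW (Finset.finite_toSet _)).trans ?_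
  rw [Set.ncard_coe_finset]
  refine (Finset.card_biUnion_le_card_mul S W (n * n * n) fun s hs => ?_).trans
    (Nat.mul_le_mul_right _ (hScard.trans hUindex))
  refine Finset.card_mul_le.trans (Nat.mul_le_mul (Finset.card_image_le.trans
    (Finset.card_mul_le.trans ?_)) (Finset.card_image_le.trans ?_))
  · rw [Finset.card_inv, hOcard]
    exact Nat.mul_le_mul (hn b hbB) (hn b hbB)
  · rw [hOcard]
    exact hn _ (B.inv_mem (hSB hs))

theorem normal_centralizer_of_conj_mem {S : Set G} (h : ∀ g, ∀ x ∈ S, g * x * g⁻¹ ∈ S) :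
    (centralizer S).Normal := by
  have := normal_closure_of_conj_mem h
  rw [← centralizer_closure]
  infer_instance

theorem index_centralizer_le [Finite G] {S : Set G} (h : ∀ g, ∀ x ∈ S, g * x * g⁻¹ ∈ S)
    {N : ℕ} (hN1 : 1 ≤ N) (hN : S.ncard ≤ N) : (centralizer S).index ≤ N ^ N := by
  have : Fintype S := Fintype.ofFinite S
  have hle : (⨅ s : S, centralizer {(s : G)}) ≤ centralizer S := by
    intro g hg
    rw [mem_centralizer_iff]
    intro s hs
    exact (mem_centralizer_singleton_iff.1 ((mem_iInf.1 hg) ⟨s, hs⟩)).symm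
  refine (index_antitone hle).trans ((index_iInf_le _).trans ?_)
  refine (Finset.prod_le_pow_card _ _ N fun s _ => ?_).trans ?_
  · rw [← relIndex_top_right]
    change (⊤ : Subgroup G).classSize s ≤ N
    rw [← ncard_conj_image]
    refine (Set.ncard_le_ncard ?_ (Set.toFinite S)).trans hN
    rintro _ ⟨g, -, rfl⟩
    exact h g s s.2
  · rw [Finset.card_univ, ← Nat.card_eq_fintype_card, Nat.card_coe_set_eq]
    exact Nat.pow_le_pow_right hN1 hN

/-- The product of the cyclic groups generated by the elements of `S` maps onto the closure. -/
theorem card_closure_le_of_commute [Finite G] {S : Set G} (h : ∀ x ∈ S, ∀ y ∈ S, Commute x y)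
    {N : ℕ} (hN1 : 1 ≤ N) (hN : S.ncard ≤ N) (hord : ∀ x ∈ S, orderOf x ≤ N) :
    Nat.card (closure S) ≤ N ^ N := by
  classical
  have : Fintype S := Fintype.ofFinite S
  have hcomm : Pairwise fun i j : S =>
      ∀ x y : G, x ∈ zpowers (i : G) → y ∈ zpowers (j : G) → Commute x y := by
    rintro i j - _ _ ⟨a, rfl⟩ ⟨b, rfl⟩
    exact (h i i.2 j j.2).zpow_zpow a b
  have hrange : closure S = (noncommPiCoprod hcomm).range := by
    rw [noncommPiCoprod_range]
    refine le_antisymm ((closure_le _).2 fun s hs => ?_) (iSup_le fun s => ?_)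
    · exact mem_iSup_of_mem (⟨s, hs⟩ : S) (mem_zpowers s)
    · exact zpowers_le.2 (subset_closure s.2)
  rw [hrange]
  refine (Nat.card_le_card_of_surjective _ (noncommPiCoprod hcomm).rangeRestrict_surjective).trans ?_
  rw [Nat.card_pi]
  refine (Finset.prod_le_pow_card _ _ N fun s _ => ?_).trans ?_
  · rw [Nat.card_zpowers]
    exact hord s s.2
  · rw [Finset.card_univ, ← Nat.card_eq_fintype_card, Nat.card_coe_set_eq]
    exact Nat.pow_le_pow_right hN1 hN

theorem exists_normal_card_commutator_le [Finite G] (B E : Subgroup G) [hB : B.Normal]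
    [hE : E.Normal] {N : ℕ} (hN1 : 1 ≤ N)
    (hN : {x | ∃ b ∈ B, ∃ e ∈ E, ⁅b, e⁆ = x}.ncard ≤ N) :
    ∃ C : Subgroup G, C.Normal ∧ C.index ≤ N ^ N ∧
      Nat.card (⁅B ⊓ C, E ⊓ C⁆ : Subgroup G) ≤ N ^ N ∧
      ⁅⁅B ⊓ C, E ⊓ C⁆, C⁆ = ⊥ := by
  set S := {x | ∃ b ∈ B, ∃ e ∈ E, ⁅b, e⁆ = x} with hS
  have hconj : ∀ g, ∀ x ∈ S, g * x * g⁻¹ ∈ S := by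
    rintro g _ ⟨b, hb, e, he, rfl⟩
    exact ⟨_, hB.conj_mem b hb g, _, hE.conj_mem e he g, (conjugate_commutatorElement b e g).symm⟩
  set C := centralizer S with hC
  have hCn : C.Normal := normal_centralizer_of_conj_mem hconj
  have hsub : {x | ∃ b ∈ B ⊓ C, ∃ e ∈ E ⊓ C, ⁅b, e⁆ = x} ⊆ S := by
    rintro _ ⟨b, hb, e, he, rfl⟩
    exact ⟨b, hb.1, e, he.1, rfl⟩
  refine ⟨C, hCn, index_centralizer_le hconj hN1 hN, ?_, ?_⟩
  · rw [commutator_def]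
    refine card_closure_le_of_commute ?_ hN1
      ((Set.ncard_le_ncard hsub (Set.toFinite S)).trans hN) ?_
    · rintro _ ⟨b, hb, e, he, rfl⟩ y hy
      have hx : ⁅b, e⁆ ∈ C := commutator_le_left (H₁ := C) (H₂ := C)
        (commutator_mem_commutator hb.2 he.2)
      exact (mem_centralizer_iff.1 hx y (hsub hy)).symm
    -- Since `e` commutes with $[b,e]$, one has $[b,e]^k=[b,e^k]$; all powers lie in `S`, which
    -- bounds the order.
    · rintro _ ⟨b, hb, e, he, rfl⟩
      refine le_trans ?_ hN
      rw [← Nat.card_zpowers]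
      refine Set.ncard_le_ncard (s := (zpowers ⁅b, e⁆ : Set G)) ?_ (Set.toFinite S)
      intro x hx
      obtain ⟨k, rfl⟩ := (mem_powers_iff_mem_zpowers (G := G)).2 hx
      refine ⟨b, hb.1, e ^ k, E.pow_mem he.1 k, ?_⟩
      have hc : Commute ⁅b, e⁆ e := mem_centralizer_iff.1 he.2 _ ⟨b, hb.1, e, he.1, rfl⟩
      clear hx
      induction k with
      | zero => simp
      | succ k ih =>
        simp only at ih ⊢
        rw [pow_succ e, commutatorElement_mul_right_eq_mul_conj, ih, pow_succ, mul_assoc,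
          mul_assoc, ← mul_assoc (e ^ k), (hc.pow_right k).eq.symm, mul_inv_cancel_right]
  · rw [commutator_eq_bot_iff_le_centralizer, commutator_def, closure_le]
    intro x hx
    rw [SetLike.mem_coe, mem_centralizer_iff]
    intro c hc
    exact (mem_centralizer_iff.1 hc x (hsub hx)).symm

/-! ### Stability groups of normal series -/

/-- The three subgroups lemma, applied in `G ⧸ N`. -/
theorem commutator_commutator_le_of_rotate (N : Subgroup G) [N.Normal] {H₁ H₂ H₃ : Subgroup G}
    (h₁ : ⁅⁅H₂, H₃⁆, H₁⁆ ≤ N) (h₂ : ⁅⁅H₃, H₁⁆, H₂⁆ ≤ N) : ⁅⁅H₁, H₂⁆, H₃⁆ ≤ N := by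
  rw [← QuotientGroup.ker_mk' N, ← map_eq_bot_iff] at *
  simp only [map_commutator] at *
  exact commutator_commutator_eq_bot_of_rotate h₁ h₂

/-- By the three subgroups lemma $[T,T]$ sends `K` into `N` and centralizes `B`, so $[[T,T],T]$
centralizes `K` and hence lies in `K`. Three further commutators with `T` pass through `B` and `N`
to the trivial group. -/
theorem isNilpotent_of_stabilizes {K B N T : Subgroup G} [K.Normal] [B.Normal] [N.Normal]
    [T.Normal] (hK : centralizer (K : Set G) ≤ K) (h₁ : ⁅K, T⁆ ≤ B) (h₂ : ⁅B, T⁆ ≤ N)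
    (h₃ : ⁅N, T⁆ = ⊥) : Group.IsNilpotent T := by
  have hTK : ⁅T, K⁆ ≤ B := commutator_comm T K ▸ h₁
  have hTB : ⁅T, B⁆ ≤ N := commutator_comm T B ▸ h₂
  have hN : ∀ {H : Subgroup G}, H ≤ N → ⁅H, T⁆ = ⊥ := fun h =>
    le_bot_iff.1 ((commutator_mono h le_rfl).trans h₃.le)
  have a : ⁅⁅T, T⁆, K⁆ ≤ N := commutator_commutator_le_of_rotate N
    ((commutator_mono hTK le_rfl).trans h₂) ((commutator_mono h₁ le_rfl).trans h₂)
  have b : ⁅⁅T, T⁆, B⁆ = ⊥ := commutator_commutator_eq_bot_of_rotate (hN hTB) (hN h₂)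
  have c : ⁅⁅⁅T, T⁆, T⁆, K⁆ = ⊥ := by
    refine commutator_commutator_eq_bot_of_rotate ?_ ?_
    · refine le_bot_iff.1 ((commutator_mono hTK le_rfl).trans ?_)
      rw [commutator_comm, b]
    · exact hN (commutator_comm K ⁅T, T⁆ ▸ a)
  have d : ⁅⁅T, T⁆, T⁆ ≤ K := (commutator_eq_bot_iff_le_centralizer.1 c).trans hK
  refine isNilpotent_of_lowerCentralSeries_eq_bot (n := 5) ?_
  simp only [lowerCentralSeries_succ, lowerCentralSeries_zero]
  exact hN ((commutator_mono ((commutator_mono d le_rfl).trans h₁) le_rfl).trans h₂)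

/-- `T` is the kernel of the conjugation action on the image of `K` in `G ⧸ B`, which has at most
`j` elements. -/
theorem exists_normal_commutator_le [Finite G] {K B : Subgroup G} [K.Normal] [B.Normal] {j : ℕ}
    (hj1 : 1 ≤ j) (hj : B.relIndex K ≤ j) :
    ∃ T : Subgroup G, T.Normal ∧ T.index ≤ j ^ j ∧ ⁅K, T⁆ ≤ B := by
  set f := QuotientGroup.mk' B
  have hf : Function.Surjective f := QuotientGroup.mk'_surjective B
  have hn : (K.map f).Normal := Normal.map ‹_› f hf
  refine ⟨(centralizer (K.map f : Set (G ⧸ B))).comap f, inferInstance, ?_, ?_⟩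
  · rw [index_comap_of_surjective _ hf]
    refine index_centralizer_le (fun g x hx => hn.conj_mem x hx g) hj1 ?_
    refine le_trans (le_of_eq ?_) hj
    have : f.ker.relIndex K = Nat.card (K.map f) := relIndex_ker K f
    rw [QuotientGroup.ker_mk'] at this
    exact this.symm
  · refine le_trans ?_ (QuotientGroup.ker_mk' B : f.ker = B).le
    rw [← map_eq_bot_iff, map_commutator, commutator_comm, commutator_eq_bot_iff_le_centralizer]
    exact map_comap_le f _

/-! ### The structure theorem for a self-centralizing normal subgroup -/

theorem exists_normal_of_card_le_commutingPairs {k : ℕ} (hk : 1 ≤ k) :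
    ∃ n : ℕ, ∀ (G : Type*) [Group G] [Finite G] (K : Subgroup G) [K.Normal],
      centralizer (K : Set G) ≤ K →
      (∀ T : Subgroup G, T.Normal → Group.IsNilpotent T → T ≤ K) →
      Nat.card K * Nat.card G ≤ k * commutingPairs K ⊤ →
      ∃ R : Subgroup G, R.Normal ∧ (Group.IsNilpotent R ∧ Group.nilpotencyClass R ≤ 2) ∧
        R.index ≤ n ∧ Nat.card (⁅R, R⁆ : Subgroup G) ≤ n := by
  set n₁ := (2 * k) ^ (3 * (2 * k)) with hn₁
  set n₂ := (2 * n₁) ^ (3 * (2 * n₁)) with hn₂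
  set N₀ := n₂ ^ n₁ * (n₁ * n₁ * n₁) with hN₀
  set q := N₀ ^ N₀ with hq
  set j := 2 * k * q with hj
  have hn₁1 : 1 ≤ n₁ := Nat.one_le_pow _ _ (by omega)
  have hn₂1 : 1 ≤ n₂ := Nat.one_le_pow _ _ (by omega)
  have hN₀1 : 1 ≤ N₀ := Nat.succ_le_of_lt (by positivity)
  have hq1 : 1 ≤ q := Nat.one_le_pow _ _ hN₀1
  have hj1 : 1 ≤ j := Nat.succ_le_of_lt (by positivity)
  refine ⟨max (j * (2 * n₁ * q * j ^ j)) q, ?_⟩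
  intro G _ _ K _ hK hnil hpairs
  obtain ⟨B, hBK, hB, hBindex, hBclass⟩ := exists_normal_classSize_le K ⊤ hk (by simpa using hpairs)
  -- Every `b` in `B` has at most `n₁` conjugates, so a proportion at least `1 / n₁` of the pairs
  -- commute; this allows the second application.
  have hpairs' : Nat.card (⊤ : Subgroup G) * Nat.card B ≤ n₁ * commutingPairs ⊤ B := by
    have : Fintype B := Fintype.ofFinite B
    rw [commutingPairs_comm, commutingPairs_eq_sum, Finset.mul_sum, mul_comm,
      Nat.card_eq_fintype_card (α := B), ← smul_eq_mul, ← Finset.card_univ]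
    refine Finset.card_nsmul_le_sum _ _ _ fun b _ => ?_
    rw [← card_inf_mul_classSize ⊤ (b : G), mul_comm]
    exact Nat.mul_le_mul_right _ (hBclass b b.2)
  obtain ⟨E, -, hE, hEindex, hEclass⟩ := exists_normal_classSize_le ⊤ B hn₁1 hpairs'
  rw [relIndex_top_right] at hEindex
  have hcomm := ncard_commutators_le B E hn₂1 (n := n₁)
    (fun b hb => (relIndex_le_of_le_right le_top index_ne_zero_of_finite).trans (hBclass b hb))
    hEclass
  obtain ⟨C, hC, hCindex, hcard, hcent⟩ := exists_normal_card_commutator_le B E hN₀1 hcomm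
  have hB₀ : (B ⊓ C).relIndex K ≤ j := by
    refine relIndex_inf_le.trans (Nat.mul_le_mul hBindex ?_)
    rw [← relIndex_top_right] at hCindex
    exact (relIndex_le_of_le_right le_top index_ne_zero_of_finite).trans hCindex
  obtain ⟨T₂, hT₂, hT₂index, hT₂comm⟩ := exists_normal_commutator_le hj1 hB₀
  set T := E ⊓ C ⊓ T₂ with hT
  have hTC : T ≤ C := inf_le_left.trans inf_le_right
  have hcentT : ⁅⁅B ⊓ C, E ⊓ C⁆, T⁆ = ⊥ :=
    le_bot_iff.1 ((commutator_mono le_rfl hTC).trans hcent.le)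
  have hTindex : T.index ≤ 2 * n₁ * q * j ^ j :=
    index_inf_le.trans (Nat.mul_le_mul (index_inf_le.trans (Nat.mul_le_mul hEindex hCindex)) hT₂index)
  have hTK : T ≤ K := hnil T inferInstance (isNilpotent_of_stabilizes hK
    ((commutator_mono le_rfl inf_le_right).trans hT₂comm)
    (commutator_mono le_rfl inf_le_left) hcentT)
  have hR : ⁅B ⊓ C ⊓ T, B ⊓ C ⊓ T⁆ ≤ ⁅B ⊓ C, E ⊓ C⁆ :=
    commutator_mono inf_le_left (inf_le_right.trans inf_le_left)
  have hlcs : (B ⊓ C ⊓ T).lowerCentralSeries 2 = ⊥ := by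
    simp only [lowerCentralSeries_succ, lowerCentralSeries_zero]
    exact le_bot_iff.1 ((commutator_mono hR inf_le_right).trans hcentT.le)
  have hnilR : Group.IsNilpotent (B ⊓ C ⊓ T : Subgroup G) :=
    isNilpotent_of_lowerCentralSeries_eq_bot hlcs
  refine ⟨B ⊓ C ⊓ T, inferInstance, ⟨hnilR, ?_⟩, ?_, ?_⟩
  · rwa [← lowerCentralSeries_eq_bot_iff_nilpotencyClass_le, ← map_subtype_inj,
      top_subtype_lowerCentralSeries, map_bot]
  · refine le_trans ?_ (le_max_left _ _)
    -- Because $T\le K$, the index of `R` in `T` is at most that of $B\cap C$ in `K`.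
    rw [← relIndex_mul_index (inf_le_right : B ⊓ C ⊓ T ≤ T), inf_relIndex_right]
    exact Nat.mul_le_mul
      ((relIndex_le_of_le_right hTK index_ne_zero_of_finite).trans hB₀) hTindex
  · exact ((card_le_of_le hR).trans hcard).trans (le_max_right _ _)

end Subgroup

/-! ### The generalized Fitting subgroup of a finite group -/

namespace Subgroup

variable {G : Type*} [Group G]

theorem sSup_normal_of_map_conj_mem {S : Set (Subgroup G)}
    (h : ∀ g, ∀ H ∈ S, H.map (MulAut.conj g).toMonoidHom ∈ S) : (sSup S).Normal := by
  refine ⟨fun n hn g => ?_⟩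
  have hmem : MulAut.conj g n ∈ (sSup S).map (MulAut.conj g).toMonoidHom := ⟨n, hn, rfl⟩
  rw [sSup_eq_iSup, map_iSup] at hmem
  simp only [map_iSup] at hmem
  exact (iSup₂_le fun H hH => le_sSup (h g H hH)) hmem

/-- The largest normal `p`-subgroup. -/
def pCore (p : ℕ) (G : Type*) [Group G] : Subgroup G :=
  sSup {N : Subgroup G | N.Normal ∧ IsPGroup p N}

theorem isPGroup_pCore (p : ℕ) : IsPGroup p (pCore p G) :=
  Sylow.sSup_of_normal _ (fun _ h => h.2) (fun _ h => h.1)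

theorem le_pCore {p : ℕ} {N : Subgroup G} (hN : N.Normal) (hp : IsPGroup p N) : N ≤ pCore p G :=
  le_sSup ⟨hN, hp⟩

theorem pCore_normal (p : ℕ) : (pCore p G).Normal := by
  rw [pCore, sSup_eq_iSup']
  have : ∀ N : {N : Subgroup G | N.Normal ∧ IsPGroup p N}, (N : Subgroup G).Normal := fun N => N.2.1
  infer_instance

instance pCore_characteristic (p : ℕ) : (pCore p G).Characteristic := by
  rw [characteristic_iff_map_le]
  intro φ
  exact le_pCore (Normal.map (pCore_normal p) φ.toMonoidHom φ.surjective) ((isPGroup_pCore p).map _)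

theorem pCore_le_fittingSubgroup [Finite G] {p : ℕ} (hp : p.Prime) :
    pCore p G ≤ fittingSubgroup G := by
  have := Fact.mk hp
  exact le_sSup ⟨inferInstance, (isPGroup_pCore p).isNilpotent⟩

/-- Induct on $|G|$ through a proper normal subgroup containing `P`: its `p`-core is characteristic
in it, hence normal in `G`. -/
theorem IsSubnormal.le_pCore {p : ℕ} : ∀ {G : Type*} [Group G] [Finite G] {P : Subgroup G},
    P.IsSubnormal → IsPGroup p P → P ≤ pCore p G := by
  intro G _ _
  induction hn : Nat.card G using Nat.strong_induction_on generalizing G with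
  | _ n ih =>
    intro P hP hp
    obtain rfl | hne := eq_or_ne P ⊤
    · exact Subgroup.le_pCore inferInstance hp
    · obtain ⟨K, hK, hPK, hlt⟩ := hP.exists_normal_and_le_and_lt_top_of_ne hne
      have hcard : Nat.card K < n := by
        rw [← hn]
        exact lt_of_le_of_ne (card_le_card_group K) fun h => hlt.ne (eq_top_of_card_eq K h)
      have h₁ := ih _ hcard (G := K) rfl (hP.subgroupOf (K := K))
        (hp.of_equiv (subgroupOfEquivOfLe hPK).symm)
      have h₂ : (pCore p K).map K.subtype ≤ pCore p G :=
        Subgroup.le_pCore inferInstance ((isPGroup_pCore p).map _)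
      refine le_trans ?_ h₂
      rw [← map_subgroupOf_eq_of_le hPK]
      exact map_mono h₁

/-- Sylow subgroups of `H` are normal in `H`, hence subnormal in `G`, and lie in the `p`-cores. So
no prime divides the index of the part of `H` inside the Fitting subgroup. -/
theorem IsSubnormal.le_fittingSubgroup [Finite G] {H : Subgroup G} (hH : H.IsSubnormal)
    [Group.IsNilpotent H] : H ≤ fittingSubgroup G := by
  rw [← subgroupOf_eq_top, ← index_eq_one, Nat.eq_one_iff_not_exists_prime_dvd]
  intro p hp hdvd
  have := Fact.mk hp
  let P : Sylow p H := default
  have hP : (P : Subgroup H) ≤ (fittingSubgroup G).subgroupOf H := by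
    refine map_le_iff_le_comap.1 ?_
    have hn : (P : Subgroup H).Normal := inferInstance
    exact ((hn.isSubnormal.trans' hH).le_pCore (P.isPGroup'.map _)).trans
      (pCore_le_fittingSubgroup hp)
  exact P.not_dvd_index (hdvd.trans (index_dvd_of_le hP))

end Subgroup

/-! ### Quasisimple groups and the self-centralizing property of $F^*(G)$ -/

open Subgroup

theorem IsQuasisimpleGroup.of_mulEquiv {H H' : Type*} [Group H] [Group H'] (e : H ≃* H')
    (h : IsQuasisimpleGroup H) : IsQuasisimpleGroup H' := by
  have hc : (center H).map e.toMonoidHom = center H' := by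
    ext y
    constructor
    · rintro ⟨x, hx, rfl⟩
      refine mem_center_iff.2 fun z => e.symm.injective ?_
      simpa using mem_center_iff.1 hx (e.symm z)
    · intro hy
      refine ⟨e.symm y, mem_center_iff.2 fun z => e.injective ?_, by simp⟩
      simpa using mem_center_iff.1 hy (e z)
  let q : H ⧸ center H ≃* H' ⧸ center H' := QuotientGroup.congr _ _ e hc
  obtain ⟨hp, hs, a, b, hab⟩ := h
  refine ⟨Group.IsPerfect.ofSurjective (f := e.toMonoidHom) e.surjective, ?_, q a, q b, ?_⟩
  · exact q.symm.isSimpleGroup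
  · rw [← map_mul, ← map_mul]
    exact fun h => hab (q.injective h)

section

variable (G : Type*) [Group G]

instance fittingSubgroup_normal : (fittingSubgroup G).Normal :=
  sSup_normal_of_map_conj_mem fun g H hH =>
    ⟨hH.1.map _ (MulAut.conj g).surjective,
      (Group.isNilpotent_congr (H.equivMapOfInjective _ (MulAut.conj g).injective)).1 hH.2⟩

instance layerSubgroup_normal : (layerSubgroup G).Normal :=
  sSup_normal_of_map_conj_mem fun g H hH =>
    ⟨hH.1.map (MulAut.conj g).surjective,
      hH.2.of_mulEquiv (H.equivMapOfInjective _ (MulAut.conj g).injective)⟩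

instance generalizedFittingSubgroup_normal : (generalizedFittingSubgroup G).Normal :=
  sup_normal _ _

end

/-- A non-nilpotent group whose proper normal subgroups are all central is quasisimple. -/
theorem isQuasisimpleGroup_of_forall_le_center {H : Type*} [Group H] (hH : ¬ Group.IsNilpotent H)
    (h : ∀ M : Subgroup H, M.Normal → M ≠ ⊤ → M ≤ center H) : IsQuasisimpleGroup H := by
  have hcomm : ¬ commutator H ≤ center H := by
    intro hle
    refine hH (Subgroup.nilpotent_iff_lowerCentralSeries.2 ⟨2, ?_⟩)
    exact commutator_top_right_eq_bot_iff_le_center.2 hle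
  have hcenter : center H ≠ ⊤ := fun htop => hcomm (htop ▸ le_top)
  refine ⟨⟨?_⟩, ?_, ?_⟩
  · by_contra hne
    exact hcomm (h _ inferInstance hne)
  · have : Nontrivial (H ⧸ center H) := QuotientGroup.nontrivial_iff.2 hcenter
    refine ⟨fun N hN => ?_⟩
    have hs := QuotientGroup.mk'_surjective (center H)
    rw [← map_comap_eq_self_of_surjective hs N]
    obtain htop | hne := eq_or_ne (N.comap (QuotientGroup.mk' (center H))) ⊤
    · right
      rw [htop, map_top_of_surjective _ hs]
    · left
      rw [Subgroup.map_eq_bot_iff, QuotientGroup.ker_mk']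
      exact h _ inferInstance hne
  · by_contra! hab
    refine hcomm (commutator_le.2 fun x _ y _ => ?_)
    rw [← QuotientGroup.eq_one_iff, ← QuotientGroup.mk'_apply, map_commutatorElement,
      commutatorElement_eq_one_iff_mul_comm]
    exact hab _ _

theorem centralizer_generalizedFittingSubgroup_le {G : Type*} [Group G] [Finite G] :
    centralizer (generalizedFittingSubgroup G : Set G) ≤ generalizedFittingSubgroup G := by
  set F := generalizedFittingSubgroup G with hF
  by_contra hnot
  -- By minimality proper normal subgroups of `H` lie in `F`, which `H` centralizes, so they are
  -- central in `H`. Hence `H` is nilpotent or quasisimple, and either way lies in `F`.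
  obtain ⟨H, ⟨hHsub, hHC, hHF⟩, hmin⟩ := Set.Finite.exists_minimal
    (s := {H : Subgroup G | H.IsSubnormal ∧ H ≤ centralizer (F : Set G) ∧ ¬ H ≤ F})
    (Set.toFinite _) ⟨_, Normal.isSubnormal inferInstance, le_rfl, hnot⟩
  have hcentral : ∀ M : Subgroup H, M.Normal → M ≠ ⊤ → M ≤ center H := by
    intro M hM hne
    have hMF : M.map H.subtype ≤ F := by
      by_contra hMF
      have hle := hmin ⟨hM.isSubnormal.trans' hHsub, (map_subtype_le M).trans hHC, hMF⟩
        (map_subtype_le M)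
      refine hne (eq_top_iff.2 fun x _ => ?_)
      obtain ⟨y, hy, hyx⟩ := hle x.2
      rwa [← Subtype.ext hyx]
    intro x hx
    rw [mem_center_iff]
    intro y
    exact Subtype.ext (mem_centralizer_iff.1 (hHC y.2) x (hMF ⟨x, hx, rfl⟩)).symm
  by_cases hnil : Group.IsNilpotent H
  · exact hHF (hHsub.le_fittingSubgroup.trans le_sup_left)
  · exact hHF ((le_sSup ⟨hHsub, isQuasisimpleGroup_of_forall_le_center hnil hcentral⟩ :
      H ≤ layerSubgroup G).trans le_sup_right)

/-! ### From the probability to a count of commuting pairs -/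

theorem relCommProb_eq {G : Type*} [Group G] (K : Subgroup G) :
    relCommProb K = (commutingPairs K ⊤ : ℝ) / ((Nat.card K : ℝ) * (Nat.card G : ℝ)) := by
  have : Nat.card {p : K × G // (p.1 : G) * p.2 = p.2 * (p.1 : G)} = commutingPairs K ⊤ :=
    Nat.card_congr
      { toFun := fun p => ⟨(p.1.1, ⟨p.1.2, mem_top _⟩), p.2⟩
        invFun := fun p => ⟨(p.1.1, p.1.2), p.2⟩
        left_inv := fun _ => rfl
        right_inv := fun _ => rfl }
  rw [relCommProb, this]

theorem mainTheorem2 (ε : ℝ) (hε : 0 < ε) :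
    ∃ n : ℕ, ∀ (G : Type*) [Group G] [Finite G],
      ε ≤ relCommProb (generalizedFittingSubgroup G) →
        ∃ R : Subgroup G, R.Normal ∧
          (Group.IsNilpotent R ∧ Group.nilpotencyClass R ≤ 2) ∧
          R.index ≤ n ∧ Nat.card (⁅R, R⁆ : Subgroup G) ≤ n := by
  obtain ⟨k, hk⟩ := exists_nat_gt ε⁻¹
  have hk0 : (0 : ℝ) < k := (inv_pos.2 hε).trans hk
  obtain ⟨n, hn⟩ := exists_normal_of_card_le_commutingPairs (k := k) (by exact_mod_cast hk0)
  refine ⟨n, fun G _ _ h => hn G (generalizedFittingSubgroup G)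
    centralizer_generalizedFittingSubgroup_le
    (fun T hT hnil => (le_sSup ⟨hT, hnil⟩ : T ≤ fittingSubgroup G).trans le_sup_left) ?_⟩
  have hpos : (0 : ℝ) < Nat.card (generalizedFittingSubgroup G) * Nat.card G := by
    exact_mod_cast Nat.mul_pos Nat.card_pos Nat.card_pos
  rw [relCommProb_eq, le_div_iff₀ hpos] at h
  have hεk : 1 ≤ k * ε := by
    rw [inv_lt_iff_one_lt_mul₀ hε] at hk
    linarith
  have : (Nat.card (generalizedFittingSubgroup G) : ℝ) * Nat.card G ≤
      k * commutingPairs (generalizedFittingSubgroup G) ⊤ := by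
    calc _ ≤ (k * ε) * ((Nat.card (generalizedFittingSubgroup G) : ℝ) * Nat.card G) :=
          le_mul_of_one_le_left hpos.le hεk
      _ = k * (ε * _) := mul_assoc _ _ _
      _ ≤ _ := mul_le_mul_of_nonneg_left h hk0.le
  exact_mod_cast this
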